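/- Let $n\ge 1$, let $\mathbf X$ be any random vector in $\mathbb R^n$ (no moment or density assumption), and let $\mathbf Z\sim\mathcal N(\mathbf 0,\mathbf I_n)$ be independent of $\mathbf X$. For $\mathsf{snr}>0$ let $\mathbf Y_{\mathsf{snr}}=\sqrt{\mathsf{snr}}\,\mathbf X+\mathbf Z$. For $p\ge 0$ define the minimum mean $p$-th error $$\mathrm{mmpe}(\mathbf X,\mathsf{snr},p)=\inf_{f}\ \frac1n\,\mathbb E\Big[\mathsf{Err}^{\frac p2}\big(\mathbf X,f(\mathbf Y_{\mathsf{snr}})\big)\Big],\qquad \mathsf{Err}(\mathbf x,\mathbf v)=\mathrm{Tr}\big((\mathbf x-\mathbf v)(\mathbf x-\mathbf v)^{T}\big)=\|\mathbf x-\mathbf v\|^2,$$ where the infimum is over all Borel measurable functions $f:\mathbb R^n\to\mathbb R^n$ (and $0^0=1$ when $p=0$). Proposition. For fixed $\mathbf X$ and $p$, $\mathrm{mmpe}(\mathbf X,\mathsf{snr},p)$ is finite for every $\mathsf{snr}>0$, and $\mathsf{snr}\mapsto\mathrm{mmpe}(\mathbf X,\mathsf{snr},p)$ is a continuous real-valued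 function on $(0,\infty)$. -/

import Mathlib

open MeasureTheory ProbabilityTheory Set
open scoped ENNReal

noncomputable section

/-- The squared error `Err(x, v) = Tr((x - v)(x - v)ᵀ)` of two vectors of `ℝⁿ`. -/
def sqErr {n : ℕ} (x v : EuclideanSpace ℝ (Fin n)) : ℝ :=
  (Matrix.vecMulVec (x - v).ofLp (x - v).ofLp).trace

theorem sqErr_eq_norm_sq {n : ℕ} (x v : EuclideanSpace ℝ (Fin n)) :
    sqErr x v = ‖x - v‖ ^ 2 := by
  rw [sqErr, EuclideanSpace.norm_sq_eq]
  simp [Matrix.trace, Matrix.vecMulVec_apply, sq]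

/-- The `p`-th error `n⁻¹ 𝔼[Err^{p/2}(X, V)]` of estimating the random vector `X` by `V`,
as an extended nonnegative number (the integrand is nonnegative). -/
def pthError {Ω : Type*} [MeasurableSpace Ω] {n : ℕ} (P : Measure Ω)
    (X V : Ω → EuclideanSpace ℝ (Fin n)) (p : ℝ) : ℝ≥0∞ :=
  (n : ℝ≥0∞)⁻¹ * ∫⁻ ω, ENNReal.ofReal (sqErr (X ω) (V ω) ^ (p / 2)) ∂P

/-- The minimum mean `p`-th error of estimating `X` from `Y`: the infimum of the `p`-th error
over all estimators `f(Y)` with `f` Borel measurable. -/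
def mmpe {Ω : Type*} [MeasurableSpace Ω] {n : ℕ} (P : Measure Ω)
    (X Y : Ω → EuclideanSpace ℝ (Fin n)) (p : ℝ) : ℝ≥0∞ :=
  ⨅ (f : EuclideanSpace ℝ (Fin n) → EuclideanSpace ℝ (Fin n)) (_ : Measurable f),
    pthError P X (fun ω => f (Y ω)) p

/-- The output `Y = √snr X + Z` of the additive noise channel. -/
def channelOutput {Ω : Type*} {n : ℕ} (X Z : Ω → EuclideanSpace ℝ (Fin n)) (snr : ℝ) :
    Ω → EuclideanSpace ℝ (Fin n) :=
  fun ω => √snr • X ω + Z ω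

end

/-! Dividing the channel output by `√s` gives `X + W` with `W` Gaussian of covariance `s⁻¹ • 1`, and
estimating `X` from `X + W` is the same as estimating `W` from it (`mmpe_channelOutput`). This
removes every moment question about `X`: the zero estimator of `W` already has finite error. In this
form `s` enters only through the law of `W`, so one estimator can be tested at two levels `s`, `t`.
The change in its error is bounded by `δ` times the second moment of the error plus `δ⁻¹` times the
`χ²`-divergence (`lintegral_prod_withDensity_le`), which tends to `0` as the levels merge. The
second moment must be bounded uniformly over estimators; truncating an estimator where it is large
compared with the conditional mean of `‖W‖ ^ p` achieves this without increasing its error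
(`exists_estimator_second_moment_le`). -/

/-! ### Gaussian densities, their moments and `χ²`-divergence. -/

section GaussianDensity

/-- The density of the centred Gaussian distribution with covariance `s⁻¹ • 1`. -/
noncomputable def precisionGaussianPDF (E : Type*) [NormedAddCommGroup E] [InnerProductSpace ℝ E]
    (s : ℝ) (v : E) : ℝ :=
  (s / (2 * Real.pi)) ^ (Module.finrank ℝ E / 2 : ℝ) * Real.exp (-(s / 2) * ‖v‖ ^ 2)

/-- The centred Gaussian distribution with covariance `s⁻¹ • 1`. -/
noncomputable def precisionGaussian (E : Type*) [NormedAddCommGroup E] [InnerProductSpace ℝ E]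
    [FiniteDimensional ℝ E] [MeasurableSpace E] (s : ℝ) : Measure E :=
  (stdGaussian E).map fun z => (√s)⁻¹ • z

variable {E : Type*} [NormedAddCommGroup E] [InnerProductSpace ℝ E]

theorem precisionGaussianPDF_pos {s : ℝ} (hs : 0 < s) (v : E) :
    0 < precisionGaussianPDF E s v := by
  unfold precisionGaussianPDF; positivity

@[fun_prop]
theorem continuous_precisionGaussianPDF (s : ℝ) : Continuous (precisionGaussianPDF E s) := by
  unfold precisionGaussianPDF; fun_prop

variable [FiniteDimensional ℝ E] [MeasurableSpace E] [BorelSpace E]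

instance isProbabilityMeasure_precisionGaussian (s : ℝ) :
    IsProbabilityMeasure (precisionGaussian E s) :=
  Measure.isProbabilityMeasure_map (by fun_prop)

theorem integral_precisionGaussianPDF {s : ℝ} (hs : 0 < s) :
    ∫ v, precisionGaussianPDF E s v = 1 := by
  unfold precisionGaussianPDF
  rw [integral_const_mul, GaussianFourier.integral_rexp_neg_mul_sq_norm (by positivity),
    ← Real.mul_rpow (by positivity) (by positivity)]
  have : s / (2 * Real.pi) * (Real.pi / (s / 2)) = 1 := by field_simp
  rw [this, Real.one_rpow]

theorem integrable_precisionGaussianPDF {s : ℝ} (hs : 0 < s) :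
    Integrable (precisionGaussianPDF E s) :=
  Integrable.of_integral_ne_zero (by rw [integral_precisionGaussianPDF hs]; exact one_ne_zero)

theorem charFun_precisionGaussian {s : ℝ} (hs : 0 < s) (t : E) :
    charFun (precisionGaussian E s) t = Complex.exp (-(‖t‖ ^ 2 / (2 * s) : ℝ)) := by
  rw [precisionGaussian, charFun_map_smul, charFun_stdGaussian, norm_smul, norm_inv,
    Real.norm_of_nonneg (Real.sqrt_nonneg s)]
  congr 1
  rw [← Complex.ofReal_pow, mul_pow, inv_pow, Real.sq_sqrt hs.le]
  push_cast
  field_simp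

theorem lintegral_ofReal_precisionGaussianPDF {s : ℝ} (hs : 0 < s) :
    ∫⁻ v, ENNReal.ofReal (precisionGaussianPDF E s v) = 1 := by
  rw [← ofReal_integral_eq_lintegral_ofReal (integrable_precisionGaussianPDF hs)
    (.of_forall fun v => (precisionGaussianPDF_pos hs v).le), integral_precisionGaussianPDF hs,
    ENNReal.ofReal_one]

theorem precisionGaussian_eq_withDensity {s : ℝ} (hs : 0 < s) :
    precisionGaussian E s =
      volume.withDensity fun v => ENNReal.ofReal (precisionGaussianPDF E s v) := by
  have : IsProbabilityMeasure
      (volume.withDensity fun v : E => ENNReal.ofReal (precisionGaussianPDF E s v)) :=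
    ⟨by rw [withDensity_apply _ MeasurableSet.univ, setLIntegral_univ,
      lintegral_ofReal_precisionGaussianPDF hs]⟩
  refine Measure.ext_of_charFun (funext fun t => ?_)
  rw [charFun_precisionGaussian hs, charFun_apply, integral_withDensity_eq_integral_toReal_smul
    (by fun_prop) (by simp)]
  have hre : 0 < ((s / 2 : ℝ) : ℂ).re := by rw [Complex.ofReal_re]; positivity
  have key := GaussianFourier.integral_cexp_neg_mul_sq_norm_add hre Complex.I t
  have hint : ∀ v : E, (ENNReal.ofReal (precisionGaussianPDF E s v)).toReal •
      Complex.exp ((inner ℝ v t : ℝ) * Complex.I) =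
      (((s / (2 * Real.pi)) ^ (Module.finrank ℝ E / 2 : ℝ) : ℝ) : ℂ) *
        Complex.exp (-((s / 2 : ℝ) : ℂ) * ‖v‖ ^ 2 + Complex.I * (inner ℝ t v : ℝ)) := by
    intro v
    rw [ENNReal.toReal_ofReal (precisionGaussianPDF_pos hs v).le, precisionGaussianPDF,
      Complex.exp_add, real_inner_comm v t, Complex.real_smul, mul_comm Complex.I]
    push_cast
    ring
  simp_rw [hint]
  rw [integral_const_mul, key, ← mul_assoc]
  have hpow : ((Real.pi : ℂ) / ((s / 2 : ℝ) : ℂ)) ^ ((Module.finrank ℝ E : ℂ) / 2) =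
      (((Real.pi / (s / 2)) ^ (Module.finrank ℝ E / 2 : ℝ) : ℝ) : ℂ) := by
    rw [Complex.ofReal_cpow (by positivity)]
    push_cast
    rfl
  rw [hpow, ← Complex.ofReal_mul, ← Real.mul_rpow (by positivity) (by positivity)]
  have : s / (2 * Real.pi) * (Real.pi / (s / 2)) = 1 := by field_simp
  rw [this, Real.one_rpow, Complex.ofReal_one, one_mul, Complex.I_sq]
  congr 1
  push_cast
  field_simp
  norm_num

/-- The `χ²`-divergence of the Gaussian distributions with precisions `s` and `t`. -/
theorem lintegral_precisionGaussianPDF_chiSq {s t : ℝ} (hs : 0 < s) (ht : 0 < t)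
    (hst : t < 2 * s) :
    ∫⁻ v, ENNReal.ofReal ((precisionGaussianPDF E s v - precisionGaussianPDF E t v) ^ 2 /
        precisionGaussianPDF E t v) =
      ENNReal.ofReal ((s ^ 2 / (t * (2 * s - t))) ^ (Module.finrank ℝ E / 2 : ℝ) - 1) := by
  have hr : 0 < 2 * s - t := by linarith
  set c : ℝ := (s ^ 2 / (t * (2 * s - t))) ^ (Module.finrank ℝ E / 2 : ℝ) with hc
  -- The ratio of the squared density at `s` to the density at `t` is a multiple of the Gaussian
  -- density of precision `2 * s - t`, positive by `hst`.
  have hquot : ∀ v : E, precisionGaussianPDF E s v ^ 2 =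
      c * precisionGaussianPDF E (2 * s - t) v * precisionGaussianPDF E t v := by
    intro v
    simp only [precisionGaussianPDF, hc]
    have e1 : Real.exp (-(s / 2) * ‖v‖ ^ 2) ^ 2 =
        Real.exp (-((2 * s - t) / 2) * ‖v‖ ^ 2) * Real.exp (-(t / 2) * ‖v‖ ^ 2) := by
      rw [sq, ← Real.exp_add, ← Real.exp_add]; congr 1; ring
    have e2 : (((s / (2 * Real.pi)) ^ (Module.finrank ℝ E / 2 : ℝ)) ^ 2 : ℝ) =
        (s ^ 2 / (t * (2 * s - t))) ^ (Module.finrank ℝ E / 2 : ℝ) *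
          ((2 * s - t) / (2 * Real.pi)) ^ (Module.finrank ℝ E / 2 : ℝ) *
          (t / (2 * Real.pi)) ^ (Module.finrank ℝ E / 2 : ℝ) := by
      rw [sq, ← Real.mul_rpow (by positivity) (by positivity),
        ← Real.mul_rpow (by positivity) (by positivity),
        ← Real.mul_rpow (by positivity) (by positivity)]
      congr 1
      rw [show s ^ 2 / (t * (2 * s - t)) * ((2 * s - t) / (2 * Real.pi)) =
        s ^ 2 / (t * (2 * Real.pi)) by rw [div_mul_div_comm, mul_comm (s ^ 2), mul_comm t,
          mul_assoc, mul_div_mul_left _ _ hr.ne']]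
      field_simp
    rw [mul_pow, e1, e2]; ring
  have hexp : ∀ v : E, (precisionGaussianPDF E s v - precisionGaussianPDF E t v) ^ 2 /
      precisionGaussianPDF E t v = c * precisionGaussianPDF E (2 * s - t) v -
        2 * precisionGaussianPDF E s v + precisionGaussianPDF E t v := by
    intro v
    have := (precisionGaussianPDF_pos ht v).ne'
    rw [div_eq_iff this]
    linear_combination hquot v
  have i1 := (integrable_precisionGaussianPDF (E := E) hr).const_mul c
  have i2 := (integrable_precisionGaussianPDF (E := E) hs).const_mul 2
  have i3 := integrable_precisionGaussianPDF (E := E) ht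
  rw [← ofReal_integral_eq_lintegral_ofReal]
  · simp_rw [hexp]
    have h := integral_add (i1.sub i2) i3
    simp only [Pi.sub_apply] at h
    rw [h, integral_sub i1 i2, integral_const_mul, integral_const_mul,
      integral_precisionGaussianPDF hr, integral_precisionGaussianPDF hs,
      integral_precisionGaussianPDF ht]
    congr 1; ring
  · simp_rw [hexp]
    exact (i1.sub i2).add i3
  · exact .of_forall fun v => div_nonneg (sq_nonneg _) (precisionGaussianPDF_pos ht v).le

theorem lintegral_norm_rpow_precisionGaussian {s : ℝ} (hs : 0 < s) (q : ℝ) :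
    ∫⁻ z, ENNReal.ofReal (‖z‖ ^ q) ∂precisionGaussian E s =
      ENNReal.ofReal ((√s)⁻¹ ^ q) * ∫⁻ z, ENNReal.ofReal (‖z‖ ^ q) ∂stdGaussian E := by
  rw [precisionGaussian, lintegral_map (by fun_prop) (by fun_prop),
    ← lintegral_const_mul _ (by fun_prop)]
  refine lintegral_congr fun z => ?_
  rw [norm_smul, norm_inv, Real.norm_of_nonneg (Real.sqrt_nonneg s),
    Real.mul_rpow (by positivity) (by positivity), ENNReal.ofReal_mul (by positivity)]

theorem lintegral_norm_rpow_stdGaussian_lt_top {q : ℝ} (hq : 0 ≤ q) :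
    ∫⁻ z, ENNReal.ofReal (‖z‖ ^ q) ∂stdGaussian E < ∞ := by
  have h := (IsGaussian.memLp_id (stdGaussian E) (ENNReal.ofReal q)
    ENNReal.ofReal_ne_top).integrable_norm_rpow'
  rw [ENNReal.toReal_ofReal hq] at h
  have := h.lintegral_lt_top
  simpa using this

end GaussianDensity

/-! ### Change of noise law and truncation of estimators. -/

/-- Comparison of integrals of a nonnegative function against two product measures whose second
marginals have densities, in terms of the second moment and the `χ²`-divergence. -/
theorem lintegral_prod_withDensity_le {α β : Type*} [MeasurableSpace α] [MeasurableSpace β]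
    {μ : Measure α} [IsProbabilityMeasure μ] {ν : Measure β} [SFinite ν] {a b : β → ℝ}
    (ha : Measurable a) (hb : Measurable b) (hb0 : ∀ z, 0 < b z)
    {k : α × β → ℝ} (hk : Measurable k) (hk0 : ∀ w, 0 ≤ k w) {δ : ℝ} (hδ : 0 < δ) :
    ∫⁻ w, ENNReal.ofReal (k w) ∂μ.prod (ν.withDensity fun z => ENNReal.ofReal (a z)) ≤
      ∫⁻ w, ENNReal.ofReal (k w) ∂μ.prod (ν.withDensity fun z => ENNReal.ofReal (b z)) +
      ENNReal.ofReal δ * ∫⁻ w, ENNReal.ofReal (k w ^ 2)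
        ∂μ.prod (ν.withDensity fun z => ENNReal.ofReal (b z)) +
      ENNReal.ofReal δ⁻¹ * ∫⁻ z, ENNReal.ofReal ((a z - b z) ^ 2 / b z) ∂ν := by
  have hchi : ∫⁻ z, ENNReal.ofReal ((a z - b z) ^ 2 / b z) ∂ν =
      ∫⁻ w : α × β, ENNReal.ofReal ((a w.2 - b w.2) ^ 2 / b w.2) ∂μ.prod ν := by
    rw [lintegral_prod _ (by fun_prop)]; simp
  rw [prod_withDensity_right (by fun_prop), prod_withDensity_right (by fun_prop), hchi,
    lintegral_withDensity_eq_lintegral_mul _ (by fun_prop) (by fun_prop),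
    lintegral_withDensity_eq_lintegral_mul _ (by fun_prop) (by fun_prop),
    lintegral_withDensity_eq_lintegral_mul _ (by fun_prop) (by fun_prop),
    ← lintegral_const_mul _ (by fun_prop), ← lintegral_const_mul _ (by fun_prop),
    ← lintegral_add_left (by fun_prop), ← lintegral_add_left (by fun_prop)]
  refine lintegral_mono fun w => ?_
  have hbw := hb0 w.2
  have hkw := hk0 w
  simp only [Pi.mul_apply]
  rw [← ENNReal.ofReal_mul' hkw, ← ENNReal.ofReal_mul' hkw, ← ENNReal.ofReal_mul hbw.le,
    ← ENNReal.ofReal_mul hδ.le, ← ENNReal.ofReal_mul (by positivity),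
    ← ENNReal.ofReal_add (by positivity) (by positivity),
    ← ENNReal.ofReal_add (by positivity) (by positivity)]
  refine ENNReal.ofReal_le_ofReal ?_
  -- Young's inequality for `(a - b) * k` by completing the square; the sharp factor is `δ⁻¹ / 4`,
  -- and the spare `3 / 4` is given away.
  have h : 0 ≤ δ * b w.2 * (k w - (a w.2 - b w.2) / (2 * δ * b w.2)) ^ 2 +
      3 / 4 * (δ⁻¹ * ((a w.2 - b w.2) ^ 2 / b w.2)) := by positivity
  have e : δ * b w.2 * (k w - (a w.2 - b w.2) / (2 * δ * b w.2)) ^ 2 +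
      3 / 4 * (δ⁻¹ * ((a w.2 - b w.2) ^ 2 / b w.2)) =
      δ * (b w.2 * k w ^ 2) - (a w.2 - b w.2) * k w + δ⁻¹ * ((a w.2 - b w.2) ^ 2 / b w.2) := by
    field_simp
    ring
  rw [e] at h
  linarith

theorem Real.add_rpow_le_two_rpow_mul {a b p : ℝ} (ha : 0 ≤ a) (hb : 0 ≤ b) (hp : 0 ≤ p) :
    (a + b) ^ p ≤ 2 ^ p * (a ^ p + b ^ p) := by
  have h : (a + b) ^ p ≤ (2 * max a b) ^ p :=
    Real.rpow_le_rpow (by positivity)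
      (by linarith [le_max_left a b, le_max_right a b]) hp
  rw [Real.mul_rpow (by norm_num) (by positivity)] at h
  refine h.trans (mul_le_mul_of_nonneg_left ?_ (by positivity))
  have := Real.rpow_nonneg ha p
  have := Real.rpow_nonneg hb p
  rcases max_cases a b with ⟨h, -⟩ | ⟨h, -⟩ <;> rw [h] <;> linarith

/-- An estimator of `W` from `U` can be replaced by one whose `p`-th error is no larger and whose
`p`-th error has second moment controlled by that of `‖W‖ ^ p`. -/
theorem exists_estimator_second_moment_le {Ω E F : Type*} [MeasurableSpace Ω]
    [NormedAddCommGroup E] [MeasurableSpace E] [BorelSpace E] [SecondCountableTopology E]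
    [MeasurableSpace F] {π : Measure Ω} [IsProbabilityMeasure π] {W : Ω → E} {U : Ω → F}
    (hW : Measurable W) (hU : Measurable U) {p : ℝ} (hp : 0 ≤ p)
    (hWp : MemLp (fun ω => ‖W ω‖ ^ p) 2 π) {g : F → E} (hg : Measurable g) :
    ∃ g' : F → E, Measurable g' ∧
      ∫⁻ ω, ENNReal.ofReal (‖W ω - g' (U ω)‖ ^ p) ∂π ≤
        ∫⁻ ω, ENNReal.ofReal (‖W ω - g (U ω)‖ ^ p) ∂π ∧
      ∫⁻ ω, ENNReal.ofReal ((‖W ω - g' (U ω)‖ ^ p) ^ 2) ∂π ≤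
        ENNReal.ofReal (2 * (2 ^ p) ^ 2 * (1 + 4 * (2 ^ p) ^ 2)) *
          ∫⁻ ω, ENNReal.ofReal ((‖W ω‖ ^ p) ^ 2) ∂π := by
  classical
  set C : ℝ := 2 ^ p with hC
  have hC1 : 0 < C := by positivity
  set w : Ω → ℝ := fun ω => ‖W ω‖ ^ p with hw
  have hw0 : ∀ ω, 0 ≤ w ω := fun ω => by positivity
  have hm : MeasurableSpace.comap U inferInstance ≤ (inferInstance : MeasurableSpace Ω) :=
    hU.comap_le
  have hwint : Integrable w π := hWp.integrable one_le_two
  -- `ψ (U ω)` is the conditional expectation of `‖W‖ ^ p` given `U`.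
  obtain ⟨ψ, hψm, hψ⟩ :=
    (stronglyMeasurable_condExp (μ := π) (f := w)
      (m := MeasurableSpace.comap U inferInstance)).exists_eq_measurable_comp
  have hψmeas : Measurable ψ := hψm.measurable
  have hψint : Integrable (fun ω => ψ (U ω)) π := by
    have := integrable_condExp (μ := π) (f := w) (m := MeasurableSpace.comap U inferInstance)
    rwa [hψ] at this
  have hψ0 : ∀ᵐ ω ∂π, 0 ≤ ψ (U ω) := by
    have := condExp_nonneg (μ := π) (m := MeasurableSpace.comap U inferInstance)
      (.of_forall hw0 : 0 ≤ᵐ[π] w)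
    rwa [hψ] at this
  have hψset : ∀ A : Set F, MeasurableSet A →
      ∫ ω in U ⁻¹' A, ψ (U ω) ∂π = ∫ ω in U ⁻¹' A, w ω ∂π := by
    intro A hA
    have := setIntegral_condExp hm hwint (s := U ⁻¹' A) ⟨A, hA, rfl⟩
    rwa [hψ] at this
  have hψsq : ∫⁻ ω, ENNReal.ofReal (ψ (U ω) ^ 2) ∂π ≤ ∫⁻ ω, ENNReal.ofReal (w ω ^ 2) ∂π := by
    have h := eLpNorm_condExp_le_eLpNorm (μ := π) (m := MeasurableSpace.comap U inferInstance) w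
      one_le_two
    rw [hψ, eLpNorm_eq_lintegral_rpow_enorm_toReal two_ne_zero ENNReal.ofNat_ne_top,
      eLpNorm_eq_lintegral_rpow_enorm_toReal two_ne_zero ENNReal.ofNat_ne_top,
      ENNReal.rpow_le_rpow_iff (by norm_num)] at h
    have e : ∀ x : ℝ, ‖x‖ₑ ^ (2 : ℝ≥0∞).toReal = ENNReal.ofReal (x ^ 2) := by
      intro x
      rw [ENNReal.toReal_ofNat, ENNReal.rpow_ofNat, Real.enorm_eq_ofReal_abs,
        ← ENNReal.ofReal_pow (abs_nonneg x), sq_abs]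
    simpa only [e, Function.comp_apply] using h
  have hbound : ∀ ω, ‖g (U ω)‖ ^ p ≤ C * (‖W ω - g (U ω)‖ ^ p + w ω) := by
    intro ω
    refine le_trans (Real.rpow_le_rpow (norm_nonneg _) ?_ hp)
      (Real.add_rpow_le_two_rpow_mul (norm_nonneg _) (norm_nonneg _) hp)
    rw [← norm_sub_rev]
    simpa using norm_add_le (g (U ω) - W ω) (W ω)
  -- On `A`, `hbound` gives `2 * ψ (U) < ‖W - g (U)‖ ^ p + w`. Integrating over `U ⁻¹' A`, where `ψ
  -- (U)` and `w` have equal integrals, shows that guessing `0` there is no worse than `g`.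
  set A : Set F := {u | 2 * C * ψ u < ‖g u‖ ^ p} with hA
  have hAm : MeasurableSet A := measurableSet_lt (by fun_prop) (by fun_prop)
  have hUA : MeasurableSet (U ⁻¹' A) := hU hAm
  refine ⟨fun u => if u ∈ A then 0 else g u, Measurable.ite hAm measurable_const hg, ?_, ?_⟩
  · rw [← lintegral_add_compl _ hUA,
      ← lintegral_add_compl (fun ω => ENNReal.ofReal (‖W ω - g (U ω)‖ ^ p)) hUA]
    refine add_le_add ?_ (le_of_eq ?_)
    · have h1 : ∫⁻ ω in U ⁻¹' A,
          ENNReal.ofReal (‖W ω - (if U ω ∈ A then 0 else g (U ω))‖ ^ p) ∂π =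
          ∫⁻ ω in U ⁻¹' A, ENNReal.ofReal (w ω) ∂π :=
        setLIntegral_congr_fun hUA fun ω hω => by
          have : U ω ∈ A := hω
          simp [this, hw]
      rw [h1]
      by_cases hfin : ∫⁻ ω in U ⁻¹' A, ENNReal.ofReal (‖W ω - g (U ω)‖ ^ p) ∂π = ∞
      · rw [hfin]; exact le_top
      have hdm : Measurable fun ω => ‖W ω - g (U ω)‖ ^ p :=
        ((hW.sub (hg.comp hU)).norm).pow_const p
      have hdint : IntegrableOn (fun ω => ‖W ω - g (U ω)‖ ^ p) (U ⁻¹' A) π := by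
        refine ⟨hdm.aestronglyMeasurable, ?_⟩
        rw [hasFiniteIntegral_iff_ofReal (.of_forall fun ω => by positivity)]
        exact lt_top_iff_ne_top.2 hfin
      rw [← ofReal_integral_eq_lintegral_ofReal hwint.integrableOn (.of_forall hw0),
        ← ofReal_integral_eq_lintegral_ofReal hdint (.of_forall fun ω => by positivity)]
      refine ENNReal.ofReal_le_ofReal ?_
      have h2 : ∫ ω in U ⁻¹' A, 2 * C * ψ (U ω) ∂π ≤
          ∫ ω in U ⁻¹' A, C * (‖W ω - g (U ω)‖ ^ p + w ω) ∂π := by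
        refine setIntegral_mono_on (hψint.integrableOn.const_mul _)
          ((hdint.add hwint.integrableOn).const_mul _) hUA fun ω hω => ?_
        have : 2 * C * ψ (U ω) < ‖g (U ω)‖ ^ p := hω
        exact this.le.trans (hbound ω)
      rw [integral_const_mul, integral_const_mul, integral_add hdint hwint.integrableOn,
        hψset A hAm] at h2
      rw [mul_comm 2 C, mul_assoc] at h2
      have h3 := le_of_mul_le_mul_left h2 hC1
      linarith
    · refine setLIntegral_congr_fun hUA.compl fun ω hω => ?_
      have : U ω ∉ A := hω
      simp [this]
  · have h1 : ∀ᵐ ω ∂π,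
        ENNReal.ofReal ((‖W ω - (if U ω ∈ A then 0 else g (U ω))‖ ^ p) ^ 2) ≤
          ENNReal.ofReal (2 * C ^ 2) * ENNReal.ofReal (w ω ^ 2) +
          ENNReal.ofReal (2 * C ^ 2 * (4 * C ^ 2)) * ENNReal.ofReal (ψ (U ω) ^ 2) := by
      filter_upwards [hψ0] with ω hψω
      rw [← ENNReal.ofReal_mul (by positivity), ← ENNReal.ofReal_mul (by positivity),
        ← ENNReal.ofReal_add (by positivity) (by positivity)]
      refine ENNReal.ofReal_le_ofReal ?_
      have hC1' : 1 ≤ C := Real.one_le_rpow one_le_two hp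
      -- Off `A` the estimator is controlled by `ψ (U)`, whose second moment is at most that of `w`
      -- because conditional expectation contracts `L²`.
      have h2 : ‖W ω - (if U ω ∈ A then 0 else g (U ω))‖ ^ p ≤ C * (w ω + 2 * C * ψ (U ω)) := by
        by_cases h : U ω ∈ A
        · simp only [h, if_true, sub_zero]
          have : 0 ≤ C * (2 * C * ψ (U ω)) := by positivity
          have : w ω ≤ C * w ω := le_mul_of_one_le_left (hw0 ω) hC1'
          simp only [hw] at *
          linarith
        · simp only [h, if_false]
          have h3 : ‖g (U ω)‖ ^ p ≤ 2 * C * ψ (U ω) := not_lt.1 h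
          refine le_trans (Real.rpow_le_rpow (norm_nonneg _) (norm_sub_le _ _) hp)
            ((Real.add_rpow_le_two_rpow_mul (norm_nonneg _) (norm_nonneg _) hp).trans ?_)
          gcongr
      have h4 := pow_le_pow_left₀ (by positivity) h2 2
      refine h4.trans ?_
      have h5 : (w ω + 2 * C * ψ (U ω)) ^ 2 ≤ 2 * (w ω ^ 2 + (2 * C * ψ (U ω)) ^ 2) := by
        linarith [sq_nonneg (w ω - 2 * C * ψ (U ω))]
      calc (C * (w ω + 2 * C * ψ (U ω))) ^ 2 = C ^ 2 * (w ω + 2 * C * ψ (U ω)) ^ 2 := by ring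
        _ ≤ C ^ 2 * (2 * (w ω ^ 2 + (2 * C * ψ (U ω)) ^ 2)) := by gcongr
        _ = _ := by ring
    have hwm : Measurable w := hW.norm.pow_const p
    refine (lintegral_mono_ae h1).trans ?_
    rw [lintegral_add_left (by fun_prop), lintegral_const_mul _ (by fun_prop),
      lintegral_const_mul _ (by fun_prop)]
    refine (add_le_add_right (mul_le_mul_right hψsq _) _).trans (le_of_eq ?_)
    rw [← add_mul, ← ENNReal.ofReal_add (by positivity) (by positivity)]
    congr 2
    ring

/-! ### Finiteness and continuity of the error in estimating the noise. -/

open Filter Topology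

theorem sq_norm_rpow {E : Type*} [SeminormedAddCommGroup E] (z : E) (p : ℝ) : (‖z‖ ^ p) ^ 2 = ‖z‖ ^ (2 * p) := by
  rw [mul_comm, Real.rpow_mul (norm_nonneg z), Real.rpow_two]

/-- The minimum mean `p`-th error of estimating a centred Gaussian vector with covariance
`s⁻¹ • 1` from its sum with an independent vector of distribution `μ`. -/
noncomputable def noiseMMPE {E : Type*} [NormedAddCommGroup E] [InnerProductSpace ℝ E]
    [FiniteDimensional ℝ E] [MeasurableSpace E] (μ : Measure E) (p s : ℝ) : ℝ≥0∞ :=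
  ⨅ (g : E → E) (_ : Measurable g),
    ∫⁻ w, ENNReal.ofReal (‖w.2 - g (w.1 + w.2)‖ ^ p) ∂μ.prod (precisionGaussian E s)

section NoiseMMPE

variable {E : Type*} [NormedAddCommGroup E] [InnerProductSpace ℝ E] [FiniteDimensional ℝ E]
  [MeasurableSpace E] [BorelSpace E] {μ : Measure E} [IsProbabilityMeasure μ] {p : ℝ}

theorem lintegral_prod_norm_snd_rpow {s : ℝ} (hs : 0 < s) (q : ℝ) :
    ∫⁻ w, ENNReal.ofReal (‖w.2‖ ^ q) ∂μ.prod (precisionGaussian E s) =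
      ENNReal.ofReal ((√s)⁻¹ ^ q) * ∫⁻ z, ENNReal.ofReal (‖z‖ ^ q) ∂stdGaussian E := by
  rw [lintegral_prod _ (by fun_prop), ← lintegral_norm_rpow_precisionGaussian hs]
  simp

theorem noiseMMPE_lt_top (hp : 0 ≤ p) {s : ℝ} (hs : 0 < s) : noiseMMPE μ p s < ∞ := by
  refine (iInf₂_le (fun _ => 0) measurable_const).trans_lt ?_
  simp only [sub_zero]
  rw [lintegral_prod_norm_snd_rpow hs]
  exact ENNReal.mul_lt_top ENNReal.ofReal_lt_top (lintegral_norm_rpow_stdGaussian_lt_top hp)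

/-- Comparison of the minimum mean `p`-th errors at two noise levels. -/
theorem noiseMMPE_le_add (hp : 0 ≤ p) {s t δ : ℝ} (hs : 0 < s) (ht : 0 < t) (hst : t < 2 * s)
    (hδ : 0 < δ) :
    noiseMMPE μ p s ≤ noiseMMPE μ p t +
      ENNReal.ofReal (δ * ((√t)⁻¹ ^ (2 * p) * (2 * (2 ^ p) ^ 2 * (1 + 4 * (2 ^ p) ^ 2) *
        (∫⁻ z, ENNReal.ofReal (‖z‖ ^ (2 * p)) ∂stdGaussian E).toReal))) +
      ENNReal.ofReal (δ⁻¹ *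
        ((s ^ 2 / (t * (2 * s - t))) ^ (Module.finrank ℝ E / 2 : ℝ) - 1)) := by
  set M : ℝ≥0∞ := ∫⁻ z, ENNReal.ofReal (‖z‖ ^ (2 * p)) ∂stdGaussian E
  have hMtop : M < ∞ := lintegral_norm_rpow_stdGaussian_lt_top (by positivity)
  set π := μ.prod (precisionGaussian E t)
  have hsnd : ∫⁻ w, ENNReal.ofReal ((‖w.2‖ ^ p) ^ 2) ∂π =
      ENNReal.ofReal ((√t)⁻¹ ^ (2 * p)) * M := by
    simp_rw [sq_norm_rpow]
    exact lintegral_prod_norm_snd_rpow ht _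
  have hmem : MemLp (fun w : E × E => ‖w.2‖ ^ p) 2 π := by
    have hm : Measurable fun w : E × E => ‖w.2‖ ^ p := by fun_prop
    refine (memLp_two_iff_integrable_sq hm.aestronglyMeasurable).2
      ⟨(hm.pow_const 2).aestronglyMeasurable, ?_⟩
    rw [hasFiniteIntegral_iff_ofReal (.of_forall fun w => by positivity), hsnd]
    exact ENNReal.mul_lt_top ENNReal.ofReal_lt_top hMtop
  -- The error terms do not depend on `g`; moving them to the left lets the infimum at level `t` be
  -- treated one estimator at a time.
  rw [add_assoc, ← tsub_le_iff_right]
  refine le_iInf₂ fun g hg => ?_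
  rw [tsub_le_iff_right, ← add_assoc]
  obtain ⟨g', hg', h1, h2⟩ := exists_estimator_second_moment_le (π := π) (W := Prod.snd)
    (U := fun w : E × E => w.1 + w.2) (by fun_prop) (by fun_prop) hp hmem hg
  refine (iInf₂_le g' hg').trans ?_
  have hk : Measurable fun w : E × E => ‖w.2 - g' (w.1 + w.2)‖ ^ p := by fun_prop
  have h3 := lintegral_prod_withDensity_le (μ := μ) (ν := (volume : Measure E))
    (continuous_precisionGaussianPDF s).measurable (continuous_precisionGaussianPDF t).measurable
    (precisionGaussianPDF_pos ht) hk (fun w => by positivity) hδ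
  rw [← precisionGaussian_eq_withDensity hs, ← precisionGaussian_eq_withDensity ht,
    lintegral_precisionGaussianPDF_chiSq hs ht hst, ← ENNReal.ofReal_mul (by positivity)] at h3
  refine h3.trans (add_le_add_left (add_le_add h1 ?_) _)
  rw [ENNReal.ofReal_mul hδ.le]
  refine mul_le_mul_right (h2.trans (le_of_eq ?_)) _
  rw [hsnd, ENNReal.ofReal_mul (p := (√t)⁻¹ ^ (2 * p)) (by positivity),
    ENNReal.ofReal_mul (q := M.toReal) (by positivity), ENNReal.ofReal_toReal hMtop.ne]
  ring

theorem continuousOn_noiseMMPE (hp : 0 ≤ p) : ContinuousOn (noiseMMPE μ p) (Ioi 0) := by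
  intro s₀ (hs₀ : 0 < s₀)
  refine ContinuousAt.continuousWithinAt ?_
  set K : ℝ := 2 * (2 ^ p) ^ 2 * (1 + 4 * (2 ^ p) ^ 2) *
    (∫⁻ z, ENNReal.ofReal (‖z‖ ^ (2 * p)) ∂stdGaussian E).toReal
  set b : ℝ → ℝ := fun t => (√t)⁻¹ ^ (2 * p) * K with hb
  set χ : ℝ → ℝ → ℝ := fun s t => (s ^ 2 / (t * (2 * s - t))) ^ (Module.finrank ℝ E / 2 : ℝ) - 1
    with hχ
  have hsqrt : √s₀ ≠ 0 := (Real.sqrt_pos.2 hs₀).ne'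
  have hbc : ContinuousAt b s₀ :=
    (((Real.continuous_sqrt.continuousAt).inv₀ hsqrt).rpow_const
      (.inl (inv_ne_zero hsqrt))).mul continuousAt_const
  have hden : s₀ * (2 * s₀ - s₀) ≠ 0 := by
    have : 2 * s₀ - s₀ = s₀ := by ring
    rw [this]; positivity
  have hquot : s₀ ^ 2 / (s₀ * (2 * s₀ - s₀)) = 1 := by rw [div_eq_one_iff_eq hden]; ring
  have hχ0 : χ s₀ s₀ = 0 := by simp [hχ, hquot]
  have hχ1 : ContinuousAt (fun x => χ x s₀) s₀ := by
    refine ContinuousAt.sub (ContinuousAt.rpow_const ?_ (.inl (by rw [hquot]; exact one_ne_zero)))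
      continuousAt_const
    exact ContinuousAt.div (by fun_prop) (by fun_prop) hden
  have hχ2 : ContinuousAt (fun x => χ s₀ x) s₀ := by
    refine ContinuousAt.sub (ContinuousAt.rpow_const ?_ (.inl (by rw [hquot]; exact one_ne_zero)))
      continuousAt_const
    exact ContinuousAt.div (by fun_prop) (by fun_prop) hden
  refine (ENNReal.tendsto_nhds (noiseMMPE_lt_top hp hs₀).ne).2 fun ε hε => ?_
  -- `δ` is fixed first to make the moment term small at `s₀`; then `x` near `s₀` makes the `χ²`
  -- term small despite the factor `δ⁻¹`.
  obtain ⟨δ, hδε, hδ⟩ : ∃ δ : ℝ, ENNReal.ofReal (δ * b s₀) < ε ∧ 0 < δ := by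
    have h : Tendsto (fun δ : ℝ => ENNReal.ofReal (δ * b s₀)) (𝓝[>] 0) (𝓝 0) := by
      have : Tendsto (fun δ : ℝ => ENNReal.ofReal (δ * b s₀)) (𝓝 0)
          (𝓝 (ENNReal.ofReal (0 * b s₀))) :=
        (ENNReal.continuous_ofReal.comp (continuous_id.mul continuous_const)).tendsto 0
      rw [zero_mul, ENNReal.ofReal_zero] at this
      exact this.mono_left nhdsWithin_le_nhds
    exact ((h.eventually_lt_const hε).and self_mem_nhdsWithin).exists
  have herr : ∀ (f c : ℝ → ℝ), ContinuousAt f s₀ → ContinuousAt c s₀ → f s₀ = b s₀ → c s₀ = 0 →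
      ∀ᶠ x in 𝓝 s₀, ENNReal.ofReal (δ * f x) + ENNReal.ofReal (δ⁻¹ * c x) < ε := by
    intro f c hf hc hf0 hc0
    have h : ContinuousAt
        (fun x => ENNReal.ofReal (δ * f x) + ENNReal.ofReal (δ⁻¹ * c x)) s₀ :=
      (ENNReal.continuous_ofReal.continuousAt.comp (continuousAt_const.mul hf)).add
        (ENNReal.continuous_ofReal.continuousAt.comp (continuousAt_const.mul hc))
    refine h.eventually_lt_const ?_
    beta_reduce
    rw [hf0, hc0, mul_zero, ENNReal.ofReal_zero, add_zero]
    exact hδε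
  -- `noiseMMPE_le_add` is used in both directions between `x` and `s₀`, so each must be less than
  -- twice the other.
  have hnear : ∀ᶠ x in 𝓝 s₀, s₀ / 2 < x ∧ x < 2 * s₀ :=
    (eventually_gt_nhds (by linarith)).and (eventually_lt_nhds (by linarith))
  filter_upwards [herr _ _ continuousAt_const hχ1 rfl hχ0, herr _ _ hbc hχ2 rfl hχ0, hnear]
    with x h1 h2 ⟨hx1, hx2⟩
  have hx : 0 < x := by linarith
  refine ⟨?_, ?_⟩
  · rw [tsub_le_iff_right]
    refine (noiseMMPE_le_add hp hs₀ hx hx2 hδ).trans ?_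
    rw [add_assoc]
    exact add_le_add_right h2.le _
  · refine (noiseMMPE_le_add hp hx hs₀ (by linarith) hδ).trans ?_
    rw [add_assoc]
    exact add_le_add_right h1.le _

end NoiseMMPE

/-! ### Reduction of the channel to noise estimation. -/

section Channel

variable {Ω : Type*} [MeasurableSpace Ω] {P : Measure Ω} [IsProbabilityMeasure P] {n : ℕ}
  {X Z : Ω → EuclideanSpace ℝ (Fin n)}

theorem pthError_channelOutput (hX : AEMeasurable X P)
    (hZ : HasLaw Z (stdGaussian (EuclideanSpace ℝ (Fin n))) P) (hXZ : IndepFun X Z P) (p : ℝ)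
    {s : ℝ} (hs : 0 < s) {f : EuclideanSpace ℝ (Fin n) → EuclideanSpace ℝ (Fin n)}
    (hf : Measurable f) :
    pthError P X (fun ω => f (channelOutput X Z s ω)) p =
      (n : ℝ≥0∞)⁻¹ * ∫⁻ w, ENNReal.ofReal (‖w.1 - f (√s • (w.1 + w.2))‖ ^ p)
        ∂(P.map X).prod (precisionGaussian _ s) := by
  have hlaw : (P.map X).prod (precisionGaussian (EuclideanSpace ℝ (Fin n)) s) =
      P.map (fun ω => (X ω, (√s)⁻¹ • Z ω)) := by
    have h := (indepFun_iff_map_prod_eq_prod_map_map hX hZ.aemeasurable).1 hXZ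
    have : IsProbabilityMeasure (P.map X) := Measure.isProbabilityMeasure_map hX
    rw [hZ.map_eq] at h
    have h' := Measure.map_prod_map (P.map X) (stdGaussian (EuclideanSpace ℝ (Fin n)))
      measurable_id (measurable_const_smul (√s)⁻¹)
    rw [Measure.map_id, ← h, AEMeasurable.map_map_of_aemeasurable (by fun_prop)
      (hX.prodMk hZ.aemeasurable)] at h'
    exact h'
  rw [pthError, hlaw, lintegral_map' (by fun_prop)
    (hX.prodMk (g := fun ω => (√s)⁻¹ • Z ω) (hZ.aemeasurable.const_smul (√s)⁻¹))]
  congr 1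
  refine lintegral_congr fun ω => ?_
  have hsqrt : √s ≠ 0 := (Real.sqrt_pos.2 hs).ne'
  rw [sqErr_eq_norm_sq, channelOutput, smul_add, smul_inv_smul₀ hsqrt, ← Real.rpow_two,
    ← Real.rpow_mul (norm_nonneg _), mul_div_cancel₀ _ two_ne_zero]

/-- With `u = (√s)⁻¹ • y = X + W`, the estimators `f` of `X` and `g` of `W` correspond by `f y = u -
g u`, and then `X - f y = -(W - g u)`, so the errors agree exactly. -/
theorem mmpe_channelOutput (hX : AEMeasurable X P)
    (hZ : HasLaw Z (stdGaussian (EuclideanSpace ℝ (Fin n))) P) (hXZ : IndepFun X Z P) (hn : 0 < n)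
    (p : ℝ) {s : ℝ} (hs : 0 < s) :
    mmpe P X (channelOutput X Z s) p = (n : ℝ≥0∞)⁻¹ * noiseMMPE (P.map X) p s := by
  have hsqrt : √s ≠ 0 := (Real.sqrt_pos.2 hs).ne'
  have hn0 : (n : ℝ≥0∞)⁻¹ ≠ 0 := ENNReal.inv_ne_zero.2 (ENNReal.natCast_ne_top n)
  have hntop : (n : ℝ≥0∞)⁻¹ ≠ ∞ := ENNReal.inv_ne_top.2 (by exact_mod_cast hn.ne')
  rw [mmpe, noiseMMPE, ENNReal.mul_iInf_of_ne hn0 hntop]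
  simp_rw [ENNReal.mul_iInf_of_ne hn0 hntop]
  refine le_antisymm (le_iInf₂ fun g hg => ?_) (le_iInf₂ fun f hf => ?_)
  · have hf : Measurable fun y => (√s)⁻¹ • y - g ((√s)⁻¹ • y) := by fun_prop
    refine (iInf₂_le _ hf).trans (le_of_eq ?_)
    rw [pthError_channelOutput hX hZ hXZ p hs hf]
    congr 1
    refine lintegral_congr fun w => ?_
    rw [inv_smul_smul₀ hsqrt, ← norm_sub_rev]
    congr 3
    abel
  · refine (iInf₂_le (fun u => u - f (√s • u)) (by fun_prop)).trans (le_of_eq ?_)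
    rw [pthError_channelOutput hX hZ hXZ p hs hf]
    congr 1
    refine lintegral_congr fun w => ?_
    rw [norm_sub_rev w.2]
    rw [sub_right_comm, add_sub_cancel_right]

end Channel

theorem mainTheorem7 {Ω : Type*} [MeasurableSpace Ω] (P : Measure Ω) [IsProbabilityMeasure P]
    (n : ℕ) (hn : 0 < n) (X Z : Ω → EuclideanSpace ℝ (Fin n))
    (hX : AEMeasurable X P)
    (hZ : HasLaw Z (stdGaussian (EuclideanSpace ℝ (Fin n))) P)
    (hXZ : IndepFun X Z P) (p : ℝ) (hp : 0 ≤ p) :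
    (∀ snr : ℝ, 0 < snr → mmpe P X (channelOutput X Z snr) p < ∞) ∧
      ContinuousOn (fun snr : ℝ => (mmpe P X (channelOutput X Z snr) p).toReal) (Ioi 0) := by
  have : IsProbabilityMeasure (P.map X) := Measure.isProbabilityMeasure_map hX
  have hntop : (n : ℝ≥0∞)⁻¹ ≠ ∞ := ENNReal.inv_ne_top.2 (by exact_mod_cast hn.ne')
  have hfin : ∀ snr : ℝ, 0 < snr → mmpe P X (channelOutput X Z snr) p < ∞ := by
    intro s hs
    rw [mmpe_channelOutput hX hZ hXZ hn p hs]
    exact ENNReal.mul_lt_top hntop.lt_top (noiseMMPE_lt_top hp hs)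
  refine ⟨hfin, fun s hs => ?_⟩
  refine (ENNReal.tendsto_toReal (hfin s hs).ne).comp ?_
  rw [mmpe_channelOutput hX hZ hXZ hn p hs]
  refine (ENNReal.Tendsto.const_mul (continuousOn_noiseMMPE hp s hs) (.inr hntop)).congr' ?_
  filter_upwards [self_mem_nhdsWithin] with x hx
  exact (mmpe_channelOutput hX hZ hXZ hn p hx).symm
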